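/- **Setting.** Fix integers $0<n<m$. A *measure* on $\mathbb{R}^m$ is a Borel measure that is finite on compact sets, $\Sigma=\operatorname{supp}\mu$ is its support, and $B(x,r)$ is the open ball. An *$n$-plane* is an affine subspace of $\mathbb{R}^m$ of dimension $n$. * $\mu$ is *asymptotically optimally doubling* if for every compact $F\subset\Sigma$ and every $t\in[\tfrac12,1]$, $$\lim_{r\to0^+}\ \sup_{x\in F}\left|\frac{\mu(B(x,tr))}{\mu(B(x,r))}-t^n\right|=0 .$$ * For $S\subset\mathbb{R}^m$, $x\in S$ and $r>0$, $$\theta_S(x,r)=\frac1r\inf\{D[S\cap B(x,r),\,L\cap B(x,r)] : L \text{ an affine } n\text{-plane through } x\},$$ where $D[E,F]=\sup_{y\in E}\operatorname{dist}(y,F)+\sup_{y\in F}\operatorname{dist}(y,E)$. * $S$ is *$\epsilon$-Reifenberg flat* (of dimension $n$) if for every compact $F\subset S$ there is $r_F>0$ with $\theta_S(x,r)\le\epsilon$ for all $x\in F$ and $0<r\le r_F$. * Fix a radial function $\varphi\in C_c^\infty(\mathbb{R}^m)$ with $\chi_{B(0,2)}\le\varphi\le\chi_{B(0,3)}$. For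 a ball $B=B(x_0,r)$ with $x_0\in\Sigma$, $$\widetilde\beta_{2,\mu}(B)=\inf_{L}\left(\frac1{r^{n+2}}\int\varphi\!\left(\frac{x-x_0}{r}\right)\operatorname{dist}(x,L)^2\,d\mu(x)\right)^{1/2},$$ the infimum being over all affine $n$-planes $L\subset\mathbb{R}^m$. **Theorem.** Let $C_0>0$. For every $\epsilon>0$ and every $\varepsilon_0>0$ there is $\delta\in(0,\varepsilon_0)$, depending only on $n$, $m$, $\varphi$, $C_0$, $\varepsilon_0$ and $\epsilon$, with the following property. Let $\mu$ be an asymptotically optimally doubling measure on $\mathbb{R}^m$ with support $\Sigma\ni0$, and let $K\subset\mathbb{R}^m$ be a compact set with $B(0,2)\subset K$ such that $$C_0^{-1}r^n\le\mu(B(x,r))\le C_0r^n\qquad\text{for } x\in K\cap\Sigma,\ 0<r\le\operatorname{diam}K .$$ If $\widetilde\beta_{2,\mu}(B)\le\delta$ for every ball $B\subset B(0,2)$ centered on $K\cap\Sigma$, then there is $R>0$ such that $\theta_\Sigma(x,r)<\epsilon$ for all $x\in\Sigma\cap B(0,1)$ and $0<r<R$. Consequently $\Sigma\cap B(0,1)$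 is $\epsilon$-Reifenberg flat. -/

import Mathlib

open Set Filter Topology MeasureTheory Metric
open scoped ContDiff

noncomputable section

namespace HolderDoubling

/-- `L` is an affine `n`-plane of `ℝᵐ`. -/
def IsAffinePlane {m : ℕ} (n : ℕ) (L : AffineSubspace ℝ (EuclideanSpace ℝ (Fin m))) : Prop :=
  (L : Set (EuclideanSpace ℝ (Fin m))).Nonempty ∧ Module.finrank ℝ L.direction = n

/-- The (sum) Hausdorff distance
`D[E, F] = sup {dist(y, F) : y ∈ E} + sup {dist(y, E) : y ∈ F}`,
meant for nonempty bounded sets, where both suprema are finite. -/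
def hausdorffD {m : ℕ} (E F : Set (EuclideanSpace ℝ (Fin m))) : ℝ :=
  sSup ((fun y => infDist y F) '' E) + sSup ((fun y => infDist y E) '' F)

/-- `θ_S(x, r) = (1 / r) inf {D[S ∩ B(x, r), L ∩ B(x, r)] : L an affine n-plane through x}`
for `x ∈ S` and `r > 0`. -/
def theta {m : ℕ} (n : ℕ) (S : Set (EuclideanSpace ℝ (Fin m)))
    (x : EuclideanSpace ℝ (Fin m)) (r : ℝ) : ℝ :=
  (1 / r) * sInf {d : ℝ | ∃ L : AffineSubspace ℝ (EuclideanSpace ℝ (Fin m)),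
    IsAffinePlane n L ∧ x ∈ L ∧
      d = hausdorffD (S ∩ ball x r) ((L : Set (EuclideanSpace ℝ (Fin m))) ∩ ball x r)}

/-- `S` is `δ`-Reifenberg flat of dimension `n`: for every compact `K ⊆ S` there is `r_K > 0`
with `θ_S(x, r) ≤ δ` for all `x ∈ K` and `0 < r ≤ r_K`. The set `S` need not be closed, so that
the notion applies to the part of a closed set in an open ball. -/
def IsReifenbergFlat {m : ℕ} (n : ℕ) (δ : ℝ) (S : Set (EuclideanSpace ℝ (Fin m))) : Prop :=
  ∀ K : Set (EuclideanSpace ℝ (Fin m)), IsCompact K → K ⊆ S →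
    ∃ rK : ℝ, 0 < rK ∧ ∀ x ∈ K, ∀ r : ℝ, 0 < r → r ≤ rK → theta n S x r ≤ δ

/-- `R_t(x, r) = μ(B(x, t r)) / μ(B(x, r)) - tⁿ`. -/
def doublingDefect {m : ℕ} (n : ℕ) (μ : Measure (EuclideanSpace ℝ (Fin m))) (t : ℝ)
    (x : EuclideanSpace ℝ (Fin m)) (r : ℝ) : ℝ :=
  μ.real (ball x (t * r)) / μ.real (ball x r) - t ^ n

/-- `μ` is asymptotically optimally doubling (in dimension `n`): for every compact subset `K` of
its support and every `t ∈ [1/2, 1]`, `sup_{x ∈ K} |R_t(x, r)| → 0` as `r → 0+`.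
(The values `|R_t(x, r)|` are at most `1`, so the supremum is a genuine one.) -/
def IsAsymptoticallyOptimallyDoubling {m : ℕ} (n : ℕ)
    (μ : Measure (EuclideanSpace ℝ (Fin m))) : Prop :=
  ∀ K : Set (EuclideanSpace ℝ (Fin m)), IsCompact K → K ⊆ μ.support →
    ∀ t ∈ Icc (1 / 2 : ℝ) 1,
      Tendsto (fun r : ℝ => sSup ((fun x => |doublingDefect n μ t x r|) '' K)) (𝓝[>] 0) (𝓝 0)

/-- Two-sided Ahlfors regularity on `K` with constant `C₀`:
`C₀⁻¹ rⁿ ≤ μ(B(x, r)) ≤ C₀ rⁿ` for `x ∈ K ∩ supp μ` and `0 < r ≤ diam K`. -/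
def IsAhlforsRegularOn {m : ℕ} (n : ℕ) (C₀ : ℝ) (μ : Measure (EuclideanSpace ℝ (Fin m)))
    (K : Set (EuclideanSpace ℝ (Fin m))) : Prop :=
  ∀ x ∈ K ∩ μ.support, ∀ r : ℝ, 0 < r → r ≤ diam K →
    C₀⁻¹ * r ^ n ≤ μ.real (ball x r) ∧ μ.real (ball x r) ≤ C₀ * r ^ n

/-- `φ` is a radial `C_c^∞` function on `ℝᵐ` with `χ_{B(0,2)} ≤ φ ≤ χ_{B(0,3)}`. -/
structure IsRadialCutoff {m : ℕ} (φ : EuclideanSpace ℝ (Fin m) → ℝ) : Prop where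
  smooth : ContDiff ℝ ∞ φ
  compactSupport : HasCompactSupport φ
  radial : ∀ x y, ‖x‖ = ‖y‖ → φ x = φ y
  lower : ∀ x, (ball 0 2).indicator (fun _ => (1 : ℝ)) x ≤ φ x
  upper : ∀ x, φ x ≤ (ball 0 3).indicator (fun _ => (1 : ℝ)) x

/-- The smooth coefficient of the ball `B(x₀, r)`: the infimum over all affine `n`-planes `L` of
`(r^{-(n+2)} ∫ φ((x - x₀) / r) dist(x, L)² dμ(x))^{1/2}`. -/
def smoothBeta {m : ℕ} (n : ℕ) (φ : EuclideanSpace ℝ (Fin m) → ℝ)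
    (μ : Measure (EuclideanSpace ℝ (Fin m))) (x₀ : EuclideanSpace ℝ (Fin m)) (r : ℝ) : ℝ :=
  sInf {b : ℝ | ∃ L : AffineSubspace ℝ (EuclideanSpace ℝ (Fin m)), IsAffinePlane n L ∧
    b = Real.sqrt ((1 / r ^ (n + 2)) *
      ∫ x, φ (r⁻¹ • (x - x₀)) * infDist x (L : Set (EuclideanSpace ℝ (Fin m))) ^ 2 ∂μ)}

end HolderDoubling

end

namespace HolderDoubling

/-! Small coefficients give one-sided flatness. If a support point of `B(x, r)` were far from a
nearly optimal plane, lower regularity would put so much mass near it that the integral would be too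
large (`exists_plane_infDist_le`). It remains to exclude holes, that is, points `p` of the plane
whose distance `ρ` to the support is comparable to `r`.

Suppose `p` is such a point and `y` is a nearest support point. Doubling makes the mass of a ball of
radius `u * ρ` centred on the support near `y` approximately `u ^ n * D`, with one `D` for all
relevant centres and scales (`exists_almost_constant_density`). Take a scale `s` much smaller than
`ρ` and count pairs of a plane point near `y` and a support point at distance less than `s`.
Integrating first over the plane, the count is almost what a full plane would give. Integrating
first over the support, plane points inside the hole contribute nothing, and a fixed proportion
`(1/4) ^ n` of the plane ball is lost (`density_deficit_of_hole`).

The exception is plane points at distance comparable to `s` from the support, where only a crude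
mass bound holds. Pigeonholing over `N` scales makes them negligible. The parameters `α`, `N` and
the flatness tolerance do not depend on the measure, hence neither does `δ`; only the final radius
does. -/

lemma exists_submodule_finrank_eq {n m : ℕ} (h : n ≤ m) :
    ∃ W : Submodule ℝ (EuclideanSpace ℝ (Fin m)), Module.finrank ℝ W = n := by
  obtain ⟨f, hf⟩ := (finrank_le_iff_exists_linearMap (R := ℝ)
    (M := EuclideanSpace ℝ (Fin n)) (M' := EuclideanSpace ℝ (Fin m))).1 (by simpa using h)
  exact ⟨LinearMap.range f, by simp [LinearMap.finrank_range_of_inj hf]⟩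

section Support

variable {X : Type*} [PseudoMetricSpace X] [MeasurableSpace X] [ProperSpace X]
  {μ : Measure X} [IsFiniteMeasureOnCompacts μ]

lemma measure_ball_ne_top (x : X) (r : ℝ) : μ (ball x r) ≠ ⊤ :=
  measure_ball_lt_top.ne

lemma measureReal_ball_pos {x : X} (hx : x ∈ μ.support) {r : ℝ} (hr : 0 < r) :
    0 < μ.real (ball x r) :=
  ENNReal.toReal_pos ((Measure.mem_support_iff_forall x).1 hx _ (ball_mem_nhds x hr)).ne'
    (measure_ball_ne_top x r)

lemma measureReal_ball_mono {x y : X} {r s : ℝ} (h : r + dist x y ≤ s) :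
    μ.real (ball x r) ≤ μ.real (ball y s) :=
  measureReal_mono (ball_subset_ball' h) (measure_ball_ne_top y s)

end Support

/-! ### Scaling of mass under change of radius -/

variable {n m : ℕ} {μ : Measure (EuclideanSpace ℝ (Fin m))}

lemma abs_doublingDefect_le_one [IsFiniteMeasureOnCompacts μ] {t r : ℝ} (ht : 0 ≤ t)
    (ht' : t ≤ 1) (hr : 0 < r) (x : EuclideanSpace ℝ (Fin m)) : |doublingDefect n μ t x r| ≤ 1 := by
  have h1 : μ.real (ball x (t * r)) / μ.real (ball x r) ≤ 1 :=
    div_le_one_of_le₀ (measureReal_ball_mono (by rw [dist_self]; nlinarith)) measureReal_nonneg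
  have h2 : 0 ≤ μ.real (ball x (t * r)) / μ.real (ball x r) := by positivity
  have h3 : t ^ n ≤ 1 := pow_le_one₀ ht ht'
  have h4 : 0 ≤ t ^ n := by positivity
  rw [doublingDefect, abs_le]
  constructor <;> linarith

/-- The measure of the balls centred on `F` scales by `tⁿ` when the radius is multiplied by `t`,
up to small relative errors at small scales. -/
def ScalesUniformlyOn (n : ℕ) (μ : Measure (EuclideanSpace ℝ (Fin m)))
    (F : Set (EuclideanSpace ℝ (Fin m))) (t : ℝ) : Prop :=
  ∀ η : ℝ, 0 < η → ∃ R : ℝ, 0 < R ∧ ∀ x ∈ F, ∀ r : ℝ, 0 < r → r < R →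
    |μ.real (ball x (t * r)) - t ^ n * μ.real (ball x r)| ≤ η * μ.real (ball x r)

lemma IsAsymptoticallyOptimallyDoubling.scalesUniformlyOn_of_half_le [IsFiniteMeasureOnCompacts μ]

    (hμ : IsAsymptoticallyOptimallyDoubling n μ) {F : Set (EuclideanSpace ℝ (Fin m))}
    (hF : IsCompact F) (hFs : F ⊆ μ.support) {t : ℝ} (ht : t ∈ Icc (1 / 2 : ℝ) 1) :
    ScalesUniformlyOn n μ F t := by
  intro η hη
  have h := (hμ F hF hFs t ht).eventually (gt_mem_nhds hη)
  obtain ⟨R, hR, hRs⟩ := mem_nhdsGT_iff_exists_Ioo_subset.1 h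
  refine ⟨R, hR, fun x hx r hr hrR => ?_⟩
  have h1 : sSup ((fun x => |doublingDefect n μ t x r|) '' F) < η := hRs ⟨hr, hrR⟩
  have h2 : |doublingDefect n μ t x r| ≤ sSup ((fun x => |doublingDefect n μ t x r|) '' F) := by
    -- The real `sSup` of an unbounded set is `0`, so the bound `1` is what makes pointwise values
    -- controllable.
    refine le_csSup ⟨1, ?_⟩ (mem_image_of_mem _ hx)
    rintro _ ⟨z, -, rfl⟩
    exact abs_doublingDefect_le_one (by linarith [ht.1]) ht.2 hr z
  have hpos := measureReal_ball_pos (hFs hx) hr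
  have h3 : μ.real (ball x (t * r)) - t ^ n * μ.real (ball x r)
      = doublingDefect n μ t x r * μ.real (ball x r) := by
    rw [doublingDefect]; field_simp
  rw [h3, abs_mul, abs_of_pos hpos]
  gcongr
  linarith

lemma ScalesUniformlyOn.mul [IsFiniteMeasureOnCompacts μ]
    {F : Set (EuclideanSpace ℝ (Fin m))} {t u : ℝ}
    (ht : ScalesUniformlyOn n μ F t) (hu : ScalesUniformlyOn n μ F u)
    (ht0 : 0 < t) (ht1 : t ≤ 1) (hu0 : 0 < u) (hu1 : u ≤ 1) :
    ScalesUniformlyOn n μ F (t * u) := by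
  intro η hη
  obtain ⟨R, hR, h1⟩ := ht (η / 2) (by positivity)
  obtain ⟨R', hR', h2⟩ := hu (η / 2) (by positivity)
  refine ⟨min R R', lt_min hR hR', fun x hx r hr hrR => ?_⟩
  have hur : u * r ≤ r := by nlinarith
  have h3 := h1 x hx (u * r) (by positivity) (hur.trans_lt (hrR.trans_le (min_le_left _ _)))
  have h4 := h2 x hx r hr (hrR.trans_le (min_le_right _ _))
  have h5 : μ.real (ball x (u * r)) ≤ μ.real (ball x r) :=
    measureReal_ball_mono (by simpa using hur)
  have h6 : t ^ n ≤ 1 := pow_le_one₀ ht0.le ht1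
  calc |μ.real (ball x (t * u * r)) - (t * u) ^ n * μ.real (ball x r)|
      = |(μ.real (ball x (t * (u * r))) - t ^ n * μ.real (ball x (u * r)))
          + t ^ n * (μ.real (ball x (u * r)) - u ^ n * μ.real (ball x r))| := by
        rw [mul_assoc, mul_pow]; congr 1; ring
    _ ≤ η / 2 * μ.real (ball x (u * r)) + 1 * (η / 2 * μ.real (ball x r)) := by
        refine (abs_add_le _ _).trans (add_le_add h3 ?_)
        rw [abs_mul, abs_of_nonneg (by positivity : 0 ≤ t ^ n)]
        gcongr
    _ ≤ η / 2 * μ.real (ball x r) + 1 * (η / 2 * μ.real (ball x r)) := by gcongr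
    _ = η * μ.real (ball x r) := by ring

/-- Every ratio in `(0, 1]` is a finite product of ratios in `[1/2, 1]`, and errors add under
composition. Small ratios are needed to compare widely separated scales. -/
lemma IsAsymptoticallyOptimallyDoubling.scalesUniformlyOn [IsFiniteMeasureOnCompacts μ]
    (hμ : IsAsymptoticallyOptimallyDoubling n μ) {F : Set (EuclideanSpace ℝ (Fin m))}
    (hF : IsCompact F) (hFs : F ⊆ μ.support) {t : ℝ} (ht0 : 0 < t) (ht1 : t ≤ 1) :
    ScalesUniformlyOn n μ F t := by
  have key : ∀ k : ℕ, ∀ t : ℝ, (1 / 2 : ℝ) ^ k ≤ t → t ≤ 1 → ScalesUniformlyOn n μ F t := by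
    intro k
    induction k with
    | zero =>
      intro t h1 h2
      exact hμ.scalesUniformlyOn_of_half_le hF hFs ⟨by norm_num at h1; linarith, h2⟩
    | succ k ih =>
      intro t h1 h2
      rcases le_total (1 / 2) t with h | h
      · exact hμ.scalesUniformlyOn_of_half_le hF hFs ⟨h, h2⟩
      · have h3 : (1 / 2 : ℝ) ^ k ≤ 2 * t := by rw [pow_succ] at h1; linarith
        have h4 : (0 : ℝ) < 2 * t := lt_of_lt_of_le (by positivity) h3
        have := (hμ.scalesUniformlyOn_of_half_le hF hFs (t := 1 / 2) (by norm_num)).mul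
          (ih (2 * t) h3 (by linarith)) (by norm_num) (by norm_num) h4 (by linarith)
        rwa [show 1 / 2 * (2 * t) = t by ring] at this
  obtain ⟨k, hk⟩ := exists_pow_lt_of_lt_one ht0 (by norm_num : (1 / 2 : ℝ) < 1)
  exact key k t hk.le ht1

lemma ScalesUniformlyOn.exists_forall_mem {F : Set (EuclideanSpace ℝ (Fin m))} {T : Finset ℝ}
    (hT : ∀ t ∈ T, 0 < t ∧ ScalesUniformlyOn n μ F t) {α : ℝ} (hα : 0 < α) :
    ∃ R : ℝ, 0 < R ∧ ∀ t ∈ T, ∀ x ∈ F, ∀ r : ℝ, 0 < r → r < R →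
      |μ.real (ball x (t * r)) - t ^ n * μ.real (ball x r)| ≤ α * t ^ n * μ.real (ball x r) := by
  induction T using Finset.induction_on with
  | empty => exact ⟨1, one_pos, by simp⟩
  | insert a T _ ih =>
    obtain ⟨R, hR, h1⟩ := ih fun t ht => hT t (Finset.mem_insert_of_mem ht)
    obtain ⟨ha, hS⟩ := hT a (Finset.mem_insert_self _ _)
    obtain ⟨R', hR', h2⟩ := hS (α * a ^ n) (by positivity)
    refine ⟨min R R', lt_min hR hR', fun t ht x hx r hr hrR => ?_⟩
    rcases Finset.mem_insert.1 ht with rfl | ht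
    · exact h2 x hx r hr (hrR.trans_le (min_le_right _ _))
    · exact h1 t ht x hx r hr (hrR.trans_le (min_le_left _ _))

/-- At `α = 0` this reads `1 - (1/4) ^ n < 1`, and both sides are continuous there. They are the
normalised upper and lower bounds of the double count, so a hole would force the reverse inequality.
-/
lemma exists_volume_defect_parameter (n : ℕ) : ∃ α : ℝ, 0 < α ∧ α ≤ 1 / 16 ∧
    (1 + α) * ((1 - (1 / 4) ^ n) * (1 + α) ^ n + 2 ^ n * α)
      < (1 - α) ^ n * ((1 - α) * ((1 - 3 * α) / (1 + α)) ^ n) := by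
  have h1 : Tendsto (fun α : ℝ => (1 + α) * ((1 - (1 / 4) ^ n) * (1 + α) ^ n + 2 ^ n * α))
      (𝓝 0) (𝓝 ((1 + 0) * ((1 - (1 / 4) ^ n) * (1 + 0) ^ n + 2 ^ n * 0))) :=
    (Continuous.tendsto (by fun_prop) 0)
  have h2 : Tendsto (fun α : ℝ => (1 - α) ^ n * ((1 - α) * ((1 - 3 * α) / (1 + α)) ^ n))
      (𝓝 0) (𝓝 ((1 - 0) ^ n * ((1 - 0) * ((1 - 3 * 0) / (1 + 0)) ^ n))) := by
    refine ContinuousAt.tendsto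
      (f := fun α : ℝ => (1 - α) ^ n * ((1 - α) * ((1 - 3 * α) / (1 + α)) ^ n)) ?_
    fun_prop (disch := norm_num)
  have h3 := h1.eventually_lt h2 (by simp)
  have h4 : ∀ᶠ α : ℝ in 𝓝[>] 0, 0 < α := self_mem_nhdsWithin
  have h5 : ∀ᶠ α : ℝ in 𝓝 0, α ≤ 1 / 16 := ge_mem_nhds (by norm_num)
  obtain ⟨α, ha, hb, hc⟩ :=
    (h4.and ((h5.and h3).filter_mono nhdsWithin_le_nhds)).exists
  exact ⟨α, ha, hb, hc⟩

/-! ### One-sided flatness from the smooth coefficients -/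

/-- The infimum need not be attained, so a plane with value below `2 * δ` is taken. The condition `n
≤ m` ensures that planes exist; an empty infimum would be `0` and carry no information. -/
lemma exists_plane_lintegral_lt_of_smoothBeta_le {φ : EuclideanSpace ℝ (Fin m) → ℝ}
    (hnm : n ≤ m) {x : EuclideanSpace ℝ (Fin m)} {r δ : ℝ} (hr : 0 < r) (hδ : 0 < δ)
    (hβ : smoothBeta n φ μ x r ≤ δ) :
    ∃ L : AffineSubspace ℝ (EuclideanSpace ℝ (Fin m)), IsAffinePlane n L ∧
      ∫ z, φ (r⁻¹ • (z - x)) * infDist z (L : Set (EuclideanSpace ℝ (Fin m))) ^ 2 ∂μ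
        < 4 * δ ^ 2 * r ^ (n + 2) := by
  obtain ⟨W, hW⟩ := exists_submodule_finrank_eq hnm
  obtain ⟨_, ⟨L, hL, rfl⟩, hlt⟩ := exists_lt_of_csInf_lt
    (s := {b : ℝ | ∃ L : AffineSubspace ℝ (EuclideanSpace ℝ (Fin m)), IsAffinePlane n L ∧
    b = Real.sqrt ((1 / r ^ (n + 2)) *
      ∫ z, φ (r⁻¹ • (z - x)) * infDist z (L : Set (EuclideanSpace ℝ (Fin m))) ^ 2 ∂μ)})
    ⟨_, AffineSubspace.mk' x W, ⟨⟨x, AffineSubspace.self_mem_mk' x W⟩, by rwa [AffineSubspace.direction_mk']⟩, rfl⟩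
    (hβ.trans_lt (by linarith : δ < 2 * δ))
  refine ⟨L, hL, ?_⟩
  rw [Real.sqrt_lt' (by positivity), one_div, inv_mul_lt_iff₀ (by positivity)] at hlt
  linarith

/-- If the smooth coefficient is small, the support is close to an affine plane through the
centre, by Chebyshev's inequality and lower regularity. -/
lemma exists_plane_infDist_le [IsFiniteMeasureOnCompacts μ] {φ : EuclideanSpace ℝ (Fin m) → ℝ}
    (hnm : n ≤ m) (hφ : IsRadialCutoff φ) {C₀ : ℝ}
    {x : EuclideanSpace ℝ (Fin m)} {r δ τ : ℝ} (hr : 0 < r) (hδ : 0 < δ) (hτ : 0 < τ) (hτ1 : τ ≤ 1)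
    (hδτ : 4 * δ ^ 2 ≤ C₀⁻¹ * (τ / 2) ^ (n + 2))
    (hβ : smoothBeta n φ μ x r ≤ δ)
    (hlow : ∀ w ∈ μ.support ∩ ball x r, C₀⁻¹ * (τ * r / 2) ^ n ≤ μ.real (ball w (τ * r / 2))) :
    ∃ L : AffineSubspace ℝ (EuclideanSpace ℝ (Fin m)), IsAffinePlane n L ∧
      ∀ w ∈ μ.support ∩ ball x r, infDist w (L : Set (EuclideanSpace ℝ (Fin m))) ≤ τ * r := by
  obtain ⟨L, hL, hlt⟩ := exists_plane_lintegral_lt_of_smoothBeta_le hnm hr hδ hβ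
  refine ⟨L, hL, fun w hw => ?_⟩
  by_contra! hfar
  -- Half the distance from `w` to `L` is a radius on which the integrand stays large; as `τ ≤ 1`,
  -- this ball lies in `B(x, 2r)`, where `φ` is at least `1`.
  have hsub : ∀ z ∈ ball w (τ * r / 2),
      1 ≤ φ (r⁻¹ • (z - x)) ∧ τ * r / 2 ≤ infDist z (L : Set (EuclideanSpace ℝ (Fin m))) := by
    intro z hz
    rw [mem_ball] at hz
    have hwx := mem_ball.1 hw.2
    constructor
    · have : r⁻¹ • (z - x) ∈ ball (0 : EuclideanSpace ℝ (Fin m)) 2 := by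
        rw [mem_ball_zero_iff, norm_smul, norm_inv, Real.norm_of_nonneg hr.le, ← dist_eq_norm,
          inv_mul_lt_iff₀ hr]
        nlinarith [dist_triangle z w x]
      have h := hφ.lower (r⁻¹ • (z - x))
      rwa [indicator_of_mem this] at h
    · have := infDist_le_infDist_add_dist (s := (L : Set (EuclideanSpace ℝ (Fin m)))) (x := w)
        (y := z)
      rw [dist_comm] at this
      linarith
  have hcont : Continuous fun z =>
      φ (r⁻¹ • (z - x)) * infDist z (L : Set (EuclideanSpace ℝ (Fin m))) ^ 2 := by
    have := hφ.smooth.continuous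
    have := continuous_infDist_pt (L : Set (EuclideanSpace ℝ (Fin m)))
    fun_prop
  have hcpt : HasCompactSupport fun z =>
      φ (r⁻¹ • (z - x)) * infDist z (L : Set (EuclideanSpace ℝ (Fin m))) ^ 2 := by
    refine HasCompactSupport.mul_right (f := fun z => φ (r⁻¹ • (z - x))) ?_
    refine HasCompactSupport.of_support_subset_isCompact (isCompact_closedBall x (3 * r)) ?_
    intro z hz
    by_contra hzx
    apply hz
    have hn : r⁻¹ • (z - x) ∉ ball (0 : EuclideanSpace ℝ (Fin m)) 3 := by
      rw [mem_ball_zero_iff, norm_smul, norm_inv, Real.norm_of_nonneg hr.le, ← dist_eq_norm,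
          inv_mul_lt_iff₀ hr]
      rw [mem_closedBall] at hzx
      intro h
      apply hzx
      linarith
    have h1 := hφ.upper (r⁻¹ • (z - x))
    rw [indicator_of_notMem hn] at h1
    have h2 := hφ.lower (r⁻¹ • (z - x))
    refine le_antisymm h1 (le_trans ?_ h2)
    exact indicator_nonneg (fun _ _ => zero_le_one) _
  have hint := hcont.integrable_of_hasCompactSupport (μ := μ) hcpt
  have hφ0 : ∀ z, 0 ≤ φ z := fun z =>
    le_trans (indicator_nonneg (fun _ _ => zero_le_one) _) (hφ.lower z)
  have h1 : (τ * r / 2) ^ 2 * μ.real (ball w (τ * r / 2)) ≤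
      ∫ z, φ (r⁻¹ • (z - x)) * infDist z (L : Set (EuclideanSpace ℝ (Fin m))) ^ 2 ∂μ := by
    refine le_trans ?_ (setIntegral_le_integral (s := ball w (τ * r / 2)) hint
      (Eventually.of_forall fun z => mul_nonneg (hφ0 _) (sq_nonneg _)))
    refine setIntegral_ge_of_const_le_real measurableSet_ball (measure_ball_ne_top _ _) ?_
      hint.integrableOn
    intro z hz
    obtain ⟨ha, hb⟩ := hsub z hz
    have : (τ * r / 2) ^ 2 ≤ infDist z (L : Set (EuclideanSpace ℝ (Fin m))) ^ 2 := by gcongr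
    nlinarith [sq_nonneg (infDist z (L : Set (EuclideanSpace ℝ (Fin m))))]
  have h2 := hlow w hw
  have h3 : (τ * r / 2) ^ 2 * (C₀⁻¹ * (τ * r / 2) ^ n) ≤
      (τ * r / 2) ^ 2 * μ.real (ball w (τ * r / 2)) := by gcongr
  have h4 : (τ * r / 2) ^ 2 * (C₀⁻¹ * (τ * r / 2) ^ n)
      = C₀⁻¹ * (τ / 2) ^ (n + 2) * r ^ (n + 2) := by
    rw [show τ * r / 2 = τ / 2 * r by ring, mul_pow, mul_pow]; ring
  have h5 : 4 * δ ^ 2 * r ^ (n + 2) ≤ C₀⁻¹ * (τ / 2) ^ (n + 2) * r ^ (n + 2) := by gcongr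
  linarith

/-! ### Loss of mass caused by a hole -/

section Hole

variable [IsFiniteMeasureOnCompacts μ]
  {W : Submodule ℝ (EuclideanSpace ℝ (Fin m))} {p y : EuclideanSpace ℝ (Fin m)}

lemma volume_real_ball (hW : Module.finrank ℝ W = n) (v : W) {r : ℝ} (hr : 0 < r) :
    (volume : Measure W).real (ball v r) = r ^ n * (volume : Measure W).real (ball 0 1) := by
  rw [measureReal_def, Measure.addHaar_ball_of_pos _ _ hr, ENNReal.toReal_mul, hW,
    ENNReal.toReal_ofReal (by positivity), measureReal_def]

/-- Double counting of the pairs `(v, w)` with `v` in a ball of the plane `p + W`, `w` in the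
support, and `|p + v - w| < s`. The plane points which see the support split into `U₁`, `U₂`. -/
lemma lintegral_ball_plane_le (hW : Module.finrank ℝ W = n) {vy : W} {ρ ρ' s τ a b : ℝ}
    (hτs : τ < s) (hρ' : ρ' + s + 2 * τ ≤ ρ)
    (hvy : dist (p + (vy : EuclideanSpace ℝ (Fin m))) y ≤ τ)
    (hflat : ∀ w ∈ μ.support ∩ ball y ρ', ∃ v : W, dist (p + (v : EuclideanSpace ℝ (Fin m))) w ≤ τ)
    {U₁ U₂ : Set W} (hU₁ : MeasurableSet U₁) (hU₂ : MeasurableSet U₂) (hs₁ : U₁ ⊆ ball vy ρ)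
    (hs₂ : U₂ ⊆ ball vy ρ) (ha : 0 ≤ a) (hb : 0 ≤ b)
    (h₁ : ∀ v ∈ U₁, μ.real (ball (p + (v : EuclideanSpace ℝ (Fin m))) s) ≤ a)
    (h₂ : ∀ v ∈ U₂, μ.real (ball (p + (v : EuclideanSpace ℝ (Fin m))) s) ≤ b)
    (h₃ : ∀ v ∈ ball vy ρ, v ∉ U₁ → v ∉ U₂ →
      μ.real (ball (p + (v : EuclideanSpace ℝ (Fin m))) s) = 0) :
    (s - τ) ^ n * (volume : Measure W).real (ball 0 1) * μ.real (ball y ρ') ≤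
      a * (volume : Measure W).real U₁ + b * (volume : Measure W).real U₂ := by
  set S : Set (W × EuclideanSpace ℝ (Fin m)) :=
    {q | q.1 ∈ ball vy ρ ∧ dist (p + (q.1 : EuclideanSpace ℝ (Fin m))) q.2 < s} with hS
  have hSm : MeasurableSet S := by
    refine IsOpen.measurableSet (IsOpen.inter (isOpen_ball.preimage continuous_fst) ?_)
    exact isOpen_lt (((continuous_const.add (continuous_subtype_val.comp continuous_fst))).dist
      continuous_snd) continuous_const
  have hτ0 : 0 ≤ τ := dist_nonneg.trans hvy
  have hfub : ∫⁻ v : W, μ (Prod.mk v ⁻¹' S) = ∫⁻ w, volume ((fun v => (v, w)) ⁻¹' S) ∂μ := by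
    rw [← Measure.prod_apply hSm, Measure.prod_apply_symm hSm]
  -- If `p + v` is within `τ` of `w`, then the fibre over `w` contains `ball v (s - τ)`; the slack
  -- between `ρ'` and `ρ` keeps this ball inside `ball vy ρ`.
  have hlow : volume (ball (0 : W) (s - τ)) * μ (ball y ρ') ≤
      ∫⁻ w, volume ((fun v => (v, w)) ⁻¹' S) ∂μ := by
    rw [← setLIntegral_const]
    refine le_trans ?_ (setLIntegral_le_lintegral (ball y ρ') _)
    refine lintegral_mono_ae ?_
    have hae : ∀ᵐ w ∂μ, w ∈ μ.support := Measure.support_mem_ae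
    filter_upwards [ae_restrict_mem measurableSet_ball, ae_restrict_of_ae hae] with w hw hws
    obtain ⟨v, hv⟩ := hflat w ⟨hws, hw⟩
    rw [← Measure.addHaar_ball_center volume v]
    refine measure_mono fun u hu => ?_
    have hu' : dist (p + (u : EuclideanSpace ℝ (Fin m))) (p + (v : EuclideanSpace ℝ (Fin m)))
        < s - τ := by rw [dist_add_left]; exact hu
    have hd : dist v vy ≤ τ + ρ' + τ := by
      have : dist v vy = dist (p + (v : EuclideanSpace ℝ (Fin m))) (p + vy) := by
        rw [dist_add_left]; rfl
      rw [this]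
      have h1 := dist_triangle4 (p + (v : EuclideanSpace ℝ (Fin m))) w y (p + vy)
      rw [dist_comm y] at h1
      have := mem_ball.1 hw
      linarith
    have hu2 := mem_ball.1 hu
    refine ⟨?_, ?_⟩
    · have := dist_triangle u v vy
      simp only [mem_ball]
      linarith
    · have := dist_triangle (p + (u : EuclideanSpace ℝ (Fin m))) (p + v) w
      simp only
      linarith
  have hup : ∫⁻ v : W, μ (Prod.mk v ⁻¹' S) ≤
      ENNReal.ofReal a * volume U₁ + ENNReal.ofReal b * volume U₂ := by
    rw [← lintegral_indicator_const hU₁, ← lintegral_indicator_const hU₂,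
      ← lintegral_add_left (measurable_const.indicator hU₁)]
    refine lintegral_mono fun v => ?_
    by_cases hv : v ∈ ball vy ρ
    · have hsub : μ (Prod.mk v ⁻¹' S) ≤ μ (ball (p + (v : EuclideanSpace ℝ (Fin m))) s) := by
        refine measure_mono fun w hw => ?_
        rw [mem_ball, dist_comm]
        exact hw.2
      refine hsub.trans ?_
      rw [← ENNReal.ofReal_toReal (measure_ball_ne_top (μ := μ) (p + (v : _)) s),
        ← measureReal_def]
      by_cases hv1 : v ∈ U₁
      · rw [indicator_of_mem hv1]
        exact (ENNReal.ofReal_le_ofReal (h₁ v hv1)).trans le_self_add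
      · by_cases hv2 : v ∈ U₂
        · rw [indicator_of_mem hv2]
          exact (ENNReal.ofReal_le_ofReal (h₂ v hv2)).trans le_add_self
        · simp [h₃ v hv hv1 hv2]
    · have : Prod.mk v ⁻¹' S = ∅ := by
        ext w
        simp only [hS, mem_preimage, mem_ofPred_eq, mem_empty_iff_false, iff_false]
        exact fun h => hv h.1
      simp [this]
  have hfin₁ : volume U₁ ≠ ⊤ := ((measure_mono hs₁).trans_lt measure_ball_lt_top).ne
  have hfin₂ : volume U₂ ≠ ⊤ := ((measure_mono hs₂).trans_lt measure_ball_lt_top).ne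
  have hfinal := ENNReal.toReal_mono (by finiteness) ((hlow.trans hfub.ge).trans hup)
  rw [ENNReal.toReal_mul, ENNReal.toReal_add (by finiteness) (by finiteness), ENNReal.toReal_mul,
    ENNReal.toReal_mul, ENNReal.toReal_ofReal ha, ENNReal.toReal_ofReal hb] at hfinal
  have hv := volume_real_ball hW 0 (sub_pos.2 hτs)
  rw [← hv]
  exact hfinal

/-- Among many pairwise disjoint subsets of a set of finite measure, one is small. -/
lemma exists_measureReal_le_of_pairwiseDisjoint {X : Type*} [MeasurableSpace X] {ν : Measure X}
    {A : ℕ → Set X} {U : Set X} {N : ℕ} {α : ℝ} (hN : 1 ≤ α * N)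
    (hA : ∀ k ∈ Finset.Icc 1 N, MeasurableSet (A k)) (hAU : ∀ k ∈ Finset.Icc 1 N, A k ⊆ U)
    (hd : Set.PairwiseDisjoint (Finset.Icc 1 N : Set ℕ) A) (hU : ν U ≠ ⊤) :
    ∃ k ∈ Finset.Icc 1 N, ν.real (A k) ≤ α * ν.real U := by
  by_contra! h
  have h1 : ∑ k ∈ Finset.Icc 1 N, ν.real (A k) ≤ ν.real U := by
    rw [← measureReal_biUnion_finset (by simpa using hd) hA
      (fun k hk => measure_ne_top_of_subset (hAU k hk) hU)]
    exact measureReal_mono (iUnion₂_subset hAU) hU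
  have hN0 : 0 < N := by
    rcases Nat.eq_zero_or_pos N with rfl | h0
    · norm_num at hN
    · exact h0
  have h2 : ∑ k ∈ Finset.Icc 1 N, α * ν.real U < ∑ k ∈ Finset.Icc 1 N, ν.real (A k) :=
    Finset.sum_lt_sum_of_nonempty ⟨1, Finset.mem_Icc.2 ⟨le_rfl, hN0⟩⟩ h
  rw [Finset.sum_const, Nat.card_Icc, nsmul_eq_mul] at h2
  simp only [Nat.add_sub_cancel] at h2
  have h3 : ν.real U ≤ (N : ℝ) * (α * ν.real U) := by
    nlinarith [measureReal_nonneg (μ := ν) (s := U)]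
  linarith

/-- A measure with almost constant `n`-density whose support is close to an `n`-plane `p + W`
near a support point `y`, and misses the ball around `p` that touches the support at `y`, has a
quantitative deficit of mass around `y`. -/
lemma density_deficit_of_hole (hW : Module.finrank ℝ W = n) {ρ α D : ℝ} {N : ℕ}
    (hα : 0 < α) (hα' : α ≤ 1 / 16) (hN : 1 ≤ α * N) (hρ : 0 < ρ) (hD : 0 < D)
    (hpy : dist p y = ρ) (hy : y ∈ μ.support) (hole : ∀ w ∈ μ.support, ρ ≤ dist p w)
    (hflat : ∀ w ∈ μ.support ∩ ball y (4 * ρ),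
      ∃ v : W, dist (p + (v : EuclideanSpace ℝ (Fin m))) w ≤ α ^ (N + 1) * ρ)
    (hup₁ : ∀ w ∈ μ.support ∩ ball y (4 * ρ), ∀ k ∈ Finset.Icc 1 N,
      μ.real (ball w ((1 + α) * α ^ k * ρ)) ≤ (1 + α) * ((1 + α) * α ^ k) ^ n * D)
    (hup₂ : ∀ w ∈ μ.support ∩ ball y (4 * ρ), ∀ k ∈ Finset.Icc 1 N,
      μ.real (ball w (2 * α ^ k * ρ)) ≤ (1 + α) * (2 * α ^ k) ^ n * D)
    (hlow : (1 - α) * ((1 - 3 * α) / (1 + α)) ^ n * D ≤ μ.real (ball y ((1 - 3 * α) * ρ))) :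
    (1 - α) ^ n * ((1 - α) * ((1 - 3 * α) / (1 + α)) ^ n) ≤
      (1 + α) * ((1 - (1 / 4) ^ n) * (1 + α) ^ n + 2 ^ n * α) := by
  set κ := (volume : Measure W).real (ball 0 1) with hκ
  have hκ0 : 0 < κ := ENNReal.toReal_pos (measure_ball_pos _ _ one_pos).ne' measure_ball_lt_top.ne
  set T := μ.support with hT
  have hTc : IsClosed T := Measure.isClosed_support
  have hTne : T.Nonempty := ⟨y, hy⟩
  set a : W → EuclideanSpace ℝ (Fin m) := fun v => p + (v : EuclideanSpace ℝ (Fin m)) with ha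
  have ha_cont : Continuous a := by fun_prop
  have ha_dist : ∀ u v, dist (a u) (a v) = dist u v := fun u v => by
    simp only [ha, dist_add_left]; rfl
  have hN0 : 0 < N := by
    rcases Nat.eq_zero_or_pos N with rfl | h0
    · norm_num at hN
    · exact h0
  have hα1 : α < 1 := by linarith
  have hτα : α ^ (N + 1) ≤ α ^ 2 := pow_le_pow_of_le_one hα.le hα1.le (by omega)
  have hα2 : α ^ 2 ≤ α / 16 := by nlinarith
  set d : W → ℝ := fun v => infDist (a v) T with hd
  have hd_cont : Continuous d := (continuous_infDist_pt T).comp ha_cont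
  obtain ⟨vy, hvy⟩ := hflat y ⟨hy, mem_ball_self (by linarith)⟩
  set U : Set W := ball vy ρ with hU
  -- a scale at which few points of the plane are at intermediate distance from the support
  obtain ⟨k, hk, hksmall⟩ := exists_measureReal_le_of_pairwiseDisjoint (ν := (volume : Measure W))
    (A := fun k => U ∩ d ⁻¹' Ioo (α ^ (k + 1) * ρ) (α ^ k * ρ)) (U := U) hN
    (fun k _ => measurableSet_ball.inter (hd_cont.measurable measurableSet_Ioo))
    (fun k _ => inter_subset_left)
    (by
      intro i _ j _ hij
      refine Set.disjoint_left.2 fun v hv hv' => ?_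
      have key : ∀ i j : ℕ, i < j → α ^ (i + 1) * ρ < d v → d v < α ^ j * ρ → False := by
        intro i j h h1 h2
        have : α ^ j ≤ α ^ (i + 1) := pow_le_pow_of_le_one hα.le hα1.le h
        have : α ^ j * ρ ≤ α ^ (i + 1) * ρ := by gcongr
        linarith
      rcases lt_or_gt_of_ne hij with h | h
      · exact key i j h hv.2.1 hv'.2.2
      · exact key j i h hv'.2.1 hv.2.2)
    measure_ball_lt_top.ne
  obtain ⟨hk1, hkN⟩ := Finset.mem_Icc.1 hk
  set s := α ^ k * ρ with hs
  have hs0 : 0 < s := by positivity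
  have hsα : s ≤ α * ρ := by
    -- Scales start at `k = 1` so that `s ≤ α * ρ`, which pays for shrinking `ρ` to `(1 - 3 * α) *
    -- ρ`.
    have : α ^ k ≤ α ^ 1 := pow_le_pow_of_le_one hα.le hα1.le hk1
    rw [pow_one] at this
    exact mul_le_mul_of_nonneg_right this hρ.le
  have hτs : α ^ (N + 1) * ρ ≤ α * s := by
    have : α ^ (N + 1) ≤ α ^ (k + 1) := pow_le_pow_of_le_one hα.le hα1.le (by omega)
    calc α ^ (N + 1) * ρ ≤ α ^ (k + 1) * ρ := by gcongr
      _ = α * s := by rw [hs]; ring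
  have hαs : α ^ (k + 1) * ρ = α * s := by rw [hs]; ring
  have hτρ : α ^ (N + 1) * ρ ≤ α / 16 * ρ := by gcongr; linarith
  have hαρ : α * ρ ≤ 1 / 16 * ρ := by gcongr
  have hαρ0 : 0 < α * ρ := by positivity
  have hαs1 : α * s ≤ 1 / 16 * s := by gcongr
  set U₁ : Set W := U ∩ d ⁻¹' Iic (α * s) with hU₁
  set U₂ : Set W := U ∩ d ⁻¹' Ioo (α * s) s with hU₂
  have hUy : ∀ v ∈ U, dist (a v) y < ρ + α ^ (N + 1) * ρ := fun v hv => by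
    have h1 := dist_triangle (a v) (a vy) y
    rw [ha_dist] at h1
    have := mem_ball.1 hv
    linarith
  have hnear : ∀ v ∈ U, d v < s → ∃ w ∈ T ∩ ball y (4 * ρ), dist (a v) w = d v := by
    intro v hv hvs
    obtain ⟨w, hw, hwd⟩ := hTc.exists_infDist_eq_dist hTne (a v)
    refine ⟨w, ⟨hw, ?_⟩, hwd.symm⟩
    have h1 := dist_triangle_left w y (a v)
    have h2 := hUy v hv
    rw [← hwd] at h1
    have : d v = infDist (a v) T := rfl
    rw [mem_ball]
    linarith
  -- A ball of radius `s` about a plane point sits in a ball about its nearest support point, of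
  -- radius `(1 + α) * s` over `U₁` and `2 * s` over `U₂`. The first bound is sharp up to `α`; the
  -- second is affordable because `U₂` is small.
  have hmain := lintegral_ball_plane_le (μ := μ) (p := p) (y := y) hW (vy := vy) (ρ := ρ)
    (ρ' := (1 - 3 * α) * ρ) (s := s) (τ := α ^ (N + 1) * ρ)
    (a := (1 + α) * ((1 + α) * α ^ k) ^ n * D) (b := (1 + α) * (2 * α ^ k) ^ n * D)
    (U₁ := U₁) (U₂ := U₂) (by linarith) (by linarith) hvy
    (fun w hw => hflat w ⟨hw.1, ball_subset_ball (by linarith) hw.2⟩)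
    (measurableSet_ball.inter (hd_cont.measurable measurableSet_Iic))
    (measurableSet_ball.inter (hd_cont.measurable measurableSet_Ioo))
    inter_subset_left inter_subset_left (by positivity) (by positivity)
    (by
      intro v hv
      have hvd : d v ≤ α * s := hv.2
      obtain ⟨w, hw, hwd⟩ := hnear v hv.1 (by linarith)
      refine le_trans (measureReal_ball_mono ?_) (hup₁ w hw k hk)
      have : (1 + α) * α ^ k * ρ = s + α * s := by rw [hs]; ring
      have h2 : dist (p + (v : EuclideanSpace ℝ (Fin m))) w = d v := hwd
      rw [this, h2]
      linarith)
    (by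
      intro v hv
      have hvd : d v < s := hv.2.2
      obtain ⟨w, hw, hwd⟩ := hnear v hv.1 hvd
      refine le_trans (measureReal_ball_mono ?_) (hup₂ w hw k hk)
      have : 2 * α ^ k * ρ = s + s := by rw [hs]; ring
      have h2 : dist (p + (v : EuclideanSpace ℝ (Fin m))) w = d v := hwd
      rw [this, h2]
      linarith)
    (by
      intro v hv h1 h2
      have hvd : s ≤ d v := by
        by_contra! hlt
        rcases le_or_gt (d v) (α * s) with h | h
        · exact h1 ⟨hv, h⟩
        · exact h2 ⟨hv, h, hlt⟩
      rw [measureReal_def, measure_mono_null (t := Tᶜ) ?_ Measure.measure_compl_support,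
        ENNReal.toReal_zero]
      intro w hw hwT
      have h3 : d v ≤ dist (a v) w := infDist_le_dist_of_mem hwT
      rw [mem_ball, dist_comm] at hw
      exact absurd hw (not_lt.2 (hvd.trans h3)))
  -- the hole makes `U₁` small
  have hmid : Disjoint U₁ (ball ((1 / 2 : ℝ) • vy) (1 / 4 * ρ)) := by
    refine Set.disjoint_left.2 fun v hv hv' => ?_
    -- Since `p + vy` is almost `y`, this ball is centred near the midpoint of `p` and `y`. Its
    -- points lie within roughly `3ρ/4` of `p`, so a support point within `α * s` of one would fall
    -- into the hole.
    have hvd : d v ≤ α * s := hv.2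
    obtain ⟨w, hw, hwd⟩ := hnear v hv.1 (by linarith)
    have h1 := hole w hw.1
    have h2 := dist_triangle p (a v) w
    have h3 : dist p (a v) = ‖v‖ := by simp [ha, dist_eq_norm]
    have h4 : ‖vy‖ ≤ α ^ (N + 1) * ρ + ρ := by
      have h5 : dist p (a vy) = ‖vy‖ := by simp [ha, dist_eq_norm]
      rw [← h5]
      have := dist_triangle p y (a vy)
      rw [dist_comm y] at this
      have h6 : dist (a vy) y ≤ α ^ (N + 1) * ρ := hvy
      linarith
    have h5 : ‖v‖ ≤ ‖v - (1 / 2 : ℝ) • vy‖ + 1 / 2 * ‖vy‖ := by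
      have h6 : ‖(1 / 2 : ℝ) • vy‖ = 1 / 2 * ‖vy‖ := by rw [norm_smul]; norm_num
      rw [← h6]
      simpa using norm_add_le (v - (1 / 2 : ℝ) • vy) ((1 / 2 : ℝ) • vy)
    rw [mem_ball, dist_eq_norm] at hv'
    linarith
  have hmidU : ball ((1 / 2 : ℝ) • vy) (1 / 4 * ρ) ⊆ U := by
    refine ball_subset_ball' ?_
    have h4 : ‖vy‖ ≤ α ^ (N + 1) * ρ + ρ := by
      have h5 : dist p (a vy) = ‖vy‖ := by simp [ha, dist_eq_norm]
      rw [← h5]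
      have := dist_triangle p y (a vy)
      rw [dist_comm y] at this
      have h6 : dist (a vy) y ≤ α ^ (N + 1) * ρ := hvy
      linarith
    have h6 : dist ((1 / 2 : ℝ) • vy) vy = 1 / 2 * ‖vy‖ := by
      rw [dist_eq_norm, show (1 / 2 : ℝ) • vy - vy = (-(1 / 2 : ℝ)) • vy by module, norm_smul]
      norm_num
    rw [h6]
    linarith
  have hvolU : (volume : Measure W).real U = ρ ^ n * κ := volume_real_ball hW _ hρ
  have hvol₁ : (volume : Measure W).real U₁ ≤ (1 - (1 / 4) ^ n) * (ρ ^ n * κ) := by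
    have h1 : (volume : Measure W).real U₁ +
        (volume : Measure W).real (ball ((1 / 2 : ℝ) • vy) (1 / 4 * ρ)) ≤
        (volume : Measure W).real U := by
      rw [← measureReal_union hmid measurableSet_ball
        (measure_ne_top_of_subset inter_subset_left measure_ball_lt_top.ne)
        measure_ball_lt_top.ne]
      exact measureReal_mono (union_subset inter_subset_left hmidU) measure_ball_lt_top.ne
    rw [volume_real_ball hW _ (by positivity : 0 < 1 / 4 * ρ), hvolU, mul_pow] at h1
    linarith
  have hvol₂ : (volume : Measure W).real U₂ ≤ α * (ρ ^ n * κ) := by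
    rw [← hvolU]
    have : U₂ = U ∩ d ⁻¹' Ioo (α ^ (k + 1) * ρ) (α ^ k * ρ) := by rw [hU₂, hαs]
    rw [this]
    exact hksmall
  have hsτ : ((1 - α) * s) ^ n ≤ (s - α ^ (N + 1) * ρ) ^ n := by
    have : 0 ≤ (1 - α) * s := mul_nonneg (by linarith) hs0.le
    gcongr
    linarith
  have hα3 : 0 ≤ 1 - α := by linarith
  have hα4 : 0 ≤ 1 - 3 * α := by linarith
  have hτs' : 0 ≤ s - α ^ (N + 1) * ρ := by linarith
  have hchain : ((1 - α) * s) ^ n * κ * ((1 - α) * ((1 - 3 * α) / (1 + α)) ^ n * D) ≤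
      (1 + α) * ((1 + α) * α ^ k) ^ n * D * ((1 - (1 / 4) ^ n) * (ρ ^ n * κ)) +
        (1 + α) * (2 * α ^ k) ^ n * D * (α * (ρ ^ n * κ)) := by
    refine le_trans ?_ (hmain.trans ?_)
    · gcongr
    · gcongr
  have hfac : 0 < s ^ n * κ * D := by positivity
  refine le_of_mul_le_mul_right ?_ hfac
  have e1 : ((1 - α) * s) ^ n * κ * ((1 - α) * ((1 - 3 * α) / (1 + α)) ^ n * D) =
      (1 - α) ^ n * ((1 - α) * ((1 - 3 * α) / (1 + α)) ^ n) * (s ^ n * κ * D) := by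
    rw [mul_pow]; ring
  have e2 : (1 + α) * ((1 + α) * α ^ k) ^ n * D * ((1 - (1 / 4) ^ n) * (ρ ^ n * κ)) +
        (1 + α) * (2 * α ^ k) ^ n * D * (α * (ρ ^ n * κ)) =
      (1 + α) * ((1 - (1 / 4) ^ n) * (1 + α) ^ n + 2 ^ n * α) * (s ^ n * κ * D) := by
    rw [hs, mul_pow, mul_pow, mul_pow]; ring
  linarith

end Hole

/-! ### Comparing densities at different centres -/

/-- At small scales, an asymptotically optimally doubling measure has almost constant density
over any fixed finite range of scales. -/
lemma IsAsymptoticallyOptimallyDoubling.exists_almost_constant_density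
    [IsFiniteMeasureOnCompacts μ] (hμ : IsAsymptoticallyOptimallyDoubling n μ)
    {F : Set (EuclideanSpace ℝ (Fin m))} (hF : IsCompact F) (hFs : F ⊆ μ.support)
    {α : ℝ} (hα : 0 < α) (hα' : α ≤ 1 / 16) (N : ℕ) :
    ∃ R : ℝ, 0 < R ∧ ∀ y ∈ F, ∀ ρ : ℝ, 0 < ρ → ρ < R → μ.support ∩ ball y (4 * ρ) ⊆ F →
      ∃ D : ℝ, 0 < D ∧
        (∀ w ∈ μ.support ∩ ball y (4 * ρ), ∀ k ∈ Finset.Icc 1 N,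
          μ.real (ball w ((1 + α) * α ^ k * ρ)) ≤ (1 + α) * ((1 + α) * α ^ k) ^ n * D) ∧
        (∀ w ∈ μ.support ∩ ball y (4 * ρ), ∀ k ∈ Finset.Icc 1 N,
          μ.real (ball w (2 * α ^ k * ρ)) ≤ (1 + α) * (2 * α ^ k) ^ n * D) ∧
        (1 - α) * ((1 - 3 * α) / (1 + α)) ^ n * D ≤ μ.real (ball y ((1 - 3 * α) * ρ)) := by
  -- All masses are compared with the single ball `B(y, (M + 4)ρ)`, which contains `B(w, Mρ)` for
  -- each `w` in `B(y, 4ρ)`. Changing centre costs only the factor `(M + 4) / M = 1 + α`.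
  set M : ℝ := 4 / α with hM
  have hM0 : 0 < M := by positivity
  have hM4 : 4 ≤ M := by rw [hM, le_div_iff₀ hα]; linarith
  have hMα : M + 4 = M * (1 + α) := by rw [hM]; field_simp
  have hα3 : 0 < 1 - 3 * α := by linarith
  have hpow : ∀ k : ℕ, α ^ k ≤ 1 := fun k => pow_le_one₀ hα.le (by linarith)
  set T : Finset ℝ := insert ((1 - 3 * α) / (M + 4))
    ((Finset.Icc 1 N).image (fun k => (1 + α) * α ^ k / M) ∪
      (Finset.Icc 1 N).image (fun k => 2 * α ^ k / M)) with hT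
  have hTmem : ∀ t ∈ T, 0 < t ∧ ScalesUniformlyOn n μ F t := by
    intro t ht
    suffices h : 0 < t ∧ t ≤ 1 from ⟨h.1, hμ.scalesUniformlyOn hF hFs h.1 h.2⟩
    rw [hT, Finset.mem_insert, Finset.mem_union, Finset.mem_image, Finset.mem_image] at ht
    rcases ht with rfl | ⟨k, -, rfl⟩ | ⟨k, -, rfl⟩
    · exact ⟨by positivity, by rw [div_le_one (by positivity)]; linarith⟩
    · refine ⟨by positivity, ?_⟩
      rw [div_le_one hM0]
      nlinarith [hpow k]
    · refine ⟨by positivity, ?_⟩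
      rw [div_le_one hM0]
      linarith [hpow k]
  obtain ⟨R, hR, hRT⟩ := ScalesUniformlyOn.exists_forall_mem hTmem hα
  refine ⟨R / (M + 4), by positivity, fun y hy ρ hρ hρR hsub => ?_⟩
  rw [lt_div_iff₀ (by positivity)] at hρR
  have hup : ∀ w ∈ μ.support ∩ ball y (4 * ρ), ∀ t ∈ T, ∀ u : ℝ, t = u / M →
      μ.real (ball w (u * ρ)) ≤ (1 + α) * u ^ n * (μ.real (ball y ((M + 4) * ρ)) / M ^ n) := by
    intro w hw t ht u htu
    have h1 := hRT t ht w (hsub hw) (M * ρ) (by positivity) (by nlinarith)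
    have h2 : t * (M * ρ) = u * ρ := by rw [htu]; field_simp
    rw [h2] at h1
    have h3 : μ.real (ball w (M * ρ)) ≤ μ.real (ball y ((M + 4) * ρ)) :=
      measureReal_ball_mono (by have := mem_ball.1 hw.2; linarith)
    have ht0 := (hTmem t ht).1
    calc μ.real (ball w (u * ρ)) ≤ (1 + α) * t ^ n * μ.real (ball w (M * ρ)) := by
          linarith [(abs_le.1 h1).2]
      _ ≤ (1 + α) * t ^ n * μ.real (ball y ((M + 4) * ρ)) := by gcongr
      _ = _ := by rw [htu, div_pow]; ring
  refine ⟨μ.real (ball y ((M + 4) * ρ)) / M ^ n, ?_, ?_, ?_, ?_⟩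
  · exact div_pos (measureReal_ball_pos (hFs hy) (by positivity)) (by positivity)
  · intro w hw k hk
    refine hup w hw _ (Finset.mem_insert_of_mem (Finset.mem_union_left _
      (Finset.mem_image_of_mem _ hk))) _ rfl
  · intro w hw k hk
    refine hup w hw _ (Finset.mem_insert_of_mem (Finset.mem_union_right _
      (Finset.mem_image_of_mem _ hk))) _ rfl
  · have h1 := hRT _ (Finset.mem_insert_self _ _) y hy ((M + 4) * ρ) (by positivity)
      (by linarith)
    have h2 : (1 - 3 * α) / (M + 4) * ((M + 4) * ρ) = (1 - 3 * α) * ρ := by field_simp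
    rw [h2] at h1
    refine le_trans (le_of_eq ?_) (by linarith [(abs_le.1 h1).1] :
      (1 - α) * ((1 - 3 * α) / (M + 4)) ^ n * μ.real (ball y ((M + 4) * ρ)) ≤ _)
    generalize μ.real (ball y ((M + 4) * ρ)) = B
    rw [hMα, div_pow _ (1 + α), div_pow _ (M * (1 + α)), mul_pow]
    field_simp

/-! ### Bilateral flatness and localisation -/

/-- A set which is close to a plane around `x` and has no large holes around `x` is bilaterally
close to a plane through `x`. -/
lemma theta_lt_of_infDist_le_of_no_hole {S : Set (EuclideanSpace ℝ (Fin m))} (hS : IsClosed S)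
    {x : EuclideanSpace ℝ (Fin m)} (hx : x ∈ S) {r ε τ : ℝ} (hr : 0 < r) (hε : 0 < ε)
    (hε1 : ε ≤ 1) (hτ : 0 < τ) (hτε : τ ≤ ε / 32)
    {L : AffineSubspace ℝ (EuclideanSpace ℝ (Fin m))} (hL : IsAffinePlane n L)
    (hflat : ∀ w ∈ S ∩ ball x (8 * r), infDist w (L : Set (EuclideanSpace ℝ (Fin m))) ≤ τ * r)
    (hhole : ∀ W : Submodule ℝ (EuclideanSpace ℝ (Fin m)), Module.finrank ℝ W = n →
      ∀ p ∈ ball x r,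
      (∀ w ∈ S ∩ ball x (8 * r), ∃ v : W, dist (p + (v : EuclideanSpace ℝ (Fin m))) w ≤ 2 * τ * r) →
      ∀ y ∈ S, ε * r / 8 ≤ dist p y → dist p y < r → ¬ ∀ w ∈ S, dist p y ≤ dist p w) :
    theta n S x r < ε := by
  set W := L.direction with hW
  have hLc : IsClosed (L : Set (EuclideanSpace ℝ (Fin m))) := L.closed_of_finiteDimensional
  have hnear : ∀ w ∈ S ∩ ball x (8 * r), ∃ q ∈ L, dist w q ≤ τ * r := by
    intro w hw
    obtain ⟨q, hq, hqd⟩ := hLc.exists_infDist_eq_dist hL.1 w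
    exact ⟨q, hq, hqd ▸ hflat w hw⟩
  obtain ⟨q₀, hq₀, hxq₀⟩ := hnear x ⟨hx, mem_ball_self (by linarith)⟩
  -- Translating `L` so that it passes through `x` moves it by at most `τ * r`, hence the doubled
  -- tolerance.
  have hpar : ∀ w ∈ S ∩ ball x (8 * r), ∃ v ∈ W, dist (x + v) w ≤ 2 * τ * r := by
    intro w hw
    obtain ⟨q, hq, hqd⟩ := hnear w hw
    refine ⟨q - q₀, L.vsub_mem_direction hq hq₀, ?_⟩
    rw [dist_eq_norm] at hqd hxq₀ ⊢
    have : x + (q - q₀) - w = (x - q₀) - (w - q) := by abel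
    rw [this]
    linarith [norm_sub_le (x - q₀) (w - q)]
  set L' := AffineSubspace.mk' x W with hL'
  have hL'mem : ∀ v ∈ W, x + v ∈ L' := by
    intro v hv
    rw [hL', AffineSubspace.mem_mk']
    simpa using hv
  have hL'x : x ∈ L' := AffineSubspace.self_mem_mk' x W
  have hεr : 0 < ε * r := by positivity
  have hτr : 0 < τ * r := by positivity
  have hτr' : τ * r ≤ ε * r / 32 := by nlinarith
  have hεr1 : ε * r ≤ r := by nlinarith
  have hD : hausdorffD (S ∩ ball x r) ((L' : Set (EuclideanSpace ℝ (Fin m))) ∩ ball x r)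
      ≤ ε * r / 4 + ε * r / 4 := by
    refine add_le_add (Real.sSup_le ?_ (by positivity)) (Real.sSup_le ?_ (by positivity))
    · rintro _ ⟨w, ⟨hwS, hw⟩, rfl⟩
      obtain ⟨v, hv, hvw⟩ := hpar w ⟨hwS, ball_subset_ball (by linarith) hw⟩
      have hvn : ‖v‖ < r + 2 * τ * r := by
        have h1 := dist_triangle (x + v) w x
        rw [mem_ball] at hw
        have h2 : dist (x + v) x = ‖v‖ := by simp
        linarith
      have h2τ : 0 ≤ 1 - 2 * τ := by linarith
      -- The plane point near `w` may lie just outside the ball; contraction brings it back because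
      -- `(1 - 2τ)(1 + 2τ) ≤ 1`.
      have hmem : x + (1 - 2 * τ) • v ∈ (L' : Set (EuclideanSpace ℝ (Fin m))) ∩ ball x r := by
        refine ⟨hL'mem _ (W.smul_mem _ hv), ?_⟩
        rw [mem_ball, dist_self_add_left, norm_smul, Real.norm_of_nonneg h2τ]
        nlinarith
      refine (infDist_le_dist_of_mem hmem).trans ?_
      have h3 : dist (x + v) (x + (1 - 2 * τ) • v) = 2 * τ * ‖v‖ := by
        rw [dist_add_left, dist_eq_norm, show v - (1 - 2 * τ) • v = (2 * τ) • v by module,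
          norm_smul, Real.norm_of_nonneg (by positivity)]
      have h4 := dist_triangle_left w (x + (1 - 2 * τ) • v) (x + v)
      nlinarith
    · rintro _ ⟨p, ⟨hpL, hp⟩, rfl⟩
      rw [mem_ball] at hp
      have hpW : p - x ∈ W := by
        simpa [hL', AffineSubspace.mem_mk'] using hpL
      -- Moving `p` inwards by at most `ε * r / 8` ensures that a support point within `ε * r / 8`
      -- of `p'` still lies in `ball x r`.
      set p' := x + (1 - ε / 8) • (p - x) with hp'
      have hc : 0 ≤ 1 - ε / 8 := by linarith
      have hp'x : dist p' x ≤ (1 - ε / 8) * r := by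
        rw [hp', dist_self_add_left, norm_smul, Real.norm_of_nonneg hc, ← dist_eq_norm]
        gcongr
      have hpp' : dist p p' ≤ ε * r / 8 := by
        rw [dist_eq_norm, hp', show p - (x + (1 - ε / 8) • (p - x)) = (ε / 8) • (p - x) by module,
          norm_smul, Real.norm_of_nonneg (by positivity), ← dist_eq_norm]
        nlinarith
      obtain ⟨y, hy, hyd⟩ := hS.exists_infDist_eq_dist (nonempty_of_mem hx) p'
      have hymin : ∀ w ∈ S, dist p' y ≤ dist p' w := fun w hw => by
        rw [← hyd]; exact infDist_le_dist_of_mem hw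
      have hlt : dist p' y < ε * r / 8 := by
        by_contra! hge
        refine hhole W hL.2 p' (by rw [mem_ball]; linarith) ?_ y hy hge ?_ hymin
        · intro w hw
          obtain ⟨v, hv, hvw⟩ := hpar w hw
          refine ⟨⟨v - (1 - ε / 8) • (p - x), W.sub_mem hv (W.smul_mem _ hpW)⟩, ?_⟩
          rw [hp']
          convert hvw using 2
          simp only
          abel
        · have := hymin x hx
          linarith
      have hyball : y ∈ S ∩ ball x r := by
        refine ⟨hy, ?_⟩
        rw [mem_ball]
        have := dist_triangle_left y x p'
        linarith
      refine (infDist_le_dist_of_mem hyball).trans ?_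
      linarith [dist_triangle p p' y]
  have hL'plane : IsAffinePlane n L' :=
    ⟨⟨x, hL'x⟩, by rw [hL', AffineSubspace.direction_mk']; exact hL.2⟩
  have hle : sInf {d : ℝ | ∃ L : AffineSubspace ℝ (EuclideanSpace ℝ (Fin m)),
      IsAffinePlane n L ∧ x ∈ L ∧
        d = hausdorffD (S ∩ ball x r) ((L : Set (EuclideanSpace ℝ (Fin m))) ∩ ball x r)}
      ≤ ε * r / 4 + ε * r / 4 := by
    refine le_trans (csInf_le ⟨0, ?_⟩ ?_) hD
    swap
    · exact ⟨L', hL'plane, hL'x, rfl⟩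
    rintro _ ⟨L₁, -, -, rfl⟩
    refine add_nonneg (Real.sSup_nonneg ?_) (Real.sSup_nonneg ?_) <;>
    · rintro _ ⟨w, -, rfl⟩
      exact infDist_nonneg
  rw [theta, one_div, inv_mul_lt_iff₀ hr]
  linarith

lemma theta_inter_eq {S U : Set (EuclideanSpace ℝ (Fin m))} {x : EuclideanSpace ℝ (Fin m)}
    {r : ℝ} (h : ball x r ⊆ U) : theta n (S ∩ U) x r = theta n S x r := by
  rw [theta, theta, inter_assoc, inter_eq_right.2 h]

/-- A compact part of `S ∩ U` has a uniform thickening inside `U`, so small balls do not see the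
truncation. -/
lemma isReifenbergFlat_inter_of_isOpen {S U : Set (EuclideanSpace ℝ (Fin m))} (hU : IsOpen U)
    {ε R : ℝ} (hR : 0 < R)
    (h : ∀ x ∈ S ∩ U, ∀ r : ℝ, 0 < r → r < R → theta n S x r ≤ ε) :
    IsReifenbergFlat n ε (S ∩ U) := by
  intro F hF hFS
  obtain ⟨η, hη, hηU⟩ := hF.exists_thickening_subset_open hU (hFS.trans inter_subset_right)
  refine ⟨min η (R / 2), by positivity, fun x hx r hr hrη => ?_⟩
  rw [theta_inter_eq ((ball_subset_ball (hrη.trans (min_le_left _ _))).trans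
    ((ball_subset_thickening hx η).trans hηU))]
  exact h x (hFS hx) r hr (by linarith [hrη.trans (min_le_right _ _)])

lemma one_le_diam_of_ball_subset (hm : 0 < m) {K : Set (EuclideanSpace ℝ (Fin m))}
    (hK : IsCompact K) (h : ball (0 : EuclideanSpace ℝ (Fin m)) 2 ⊆ K) : 1 ≤ diam K := by
  have h1 : EuclideanSpace.single (⟨0, hm⟩ : Fin m) (1 : ℝ) ∈ K := h (by simp)
  have h0 : (0 : EuclideanSpace ℝ (Fin m)) ∈ K := h (by simp)
  simpa using dist_le_diam_of_mem hK.isBounded h1 h0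

end HolderDoubling

theorem theorem4p3 (n m : ℕ) (hn : 0 < n) (hnm : n < m)
    (φ : EuclideanSpace ℝ (Fin m) → ℝ) (hφ : HolderDoubling.IsRadialCutoff φ)
    (C₀ : ℝ) (hC₀ : 0 < C₀) (ε₀ : ℝ) (hε₀ : 0 < ε₀) (ε : ℝ) (hε : 0 < ε) :
    ∃ δ : ℝ, 0 < δ ∧ δ < ε₀ ∧
      ∀ (μ : Measure (EuclideanSpace ℝ (Fin m))) [IsFiniteMeasureOnCompacts μ]
        (K : Set (EuclideanSpace ℝ (Fin m))),
        HolderDoubling.IsAsymptoticallyOptimallyDoubling n μ →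
        (0 : EuclideanSpace ℝ (Fin m)) ∈ μ.support →
        IsCompact K → ball (0 : EuclideanSpace ℝ (Fin m)) 2 ⊆ K →
        HolderDoubling.IsAhlforsRegularOn n C₀ μ K →
        (∀ x₀ ∈ K ∩ μ.support, ∀ r : ℝ, 0 < r → ball x₀ r ⊆ ball 0 2 →
          HolderDoubling.smoothBeta n φ μ x₀ r ≤ δ) →
        (∃ R : ℝ, 0 < R ∧ ∀ x ∈ μ.support ∩ ball 0 1, ∀ r : ℝ, 0 < r → r < R →
          HolderDoubling.theta n μ.support x r < ε) ∧
        HolderDoubling.IsReifenbergFlat n ε (μ.support ∩ ball 0 1) := by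
  open HolderDoubling in
  obtain ⟨α, hα, hα', hαlt⟩ := exists_volume_defect_parameter n
  obtain ⟨N, hN⟩ := exists_nat_ge (1 / α)
  have hNα : 1 ≤ α * N := by rw [div_le_iff₀ hα] at hN; linarith
  set ε' := min ε 1 with hε'
  have hε'0 : 0 < ε' := lt_min hε one_pos
  have hε'1 : ε' ≤ 1 := min_le_right _ _
  -- A hole has `ρ ≥ ε' * r / 8`, so this choice turns the tolerance `2 * τ * r` into at most `α ^
  -- (N + 1) * ρ`, finer than all `N` scales.
  set τ := ε' * α ^ (N + 1) / 16 with hτ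
  have hτ0 : 0 < τ := by positivity
  have hαN : α ^ (N + 1) ≤ 1 / 2 := by
    have h1 : α ^ (N + 1) ≤ α ^ 1 := pow_le_pow_of_le_one hα.le (by linarith) (by omega)
    rw [pow_one] at h1
    linarith
  have hτε : τ ≤ ε' / 32 := by rw [hτ]; nlinarith
  -- Flatness is applied at radius `8 * r`, where tolerance `τ * r` is relative tolerance `τ / 8`.
  set c := C₀⁻¹ * (τ / 8 / 2) ^ (n + 2) with hc
  have hc0 : 0 < c := by positivity
  refine ⟨min (ε₀ / 2) (Real.sqrt (c / 4)), by positivity,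
    (min_le_left _ _).trans_lt (by linarith), ?_⟩
  set δ := min (ε₀ / 2) (Real.sqrt (c / 4)) with hδ
  have hδ0 : 0 < δ := by positivity
  have hδc : 4 * δ ^ 2 ≤ c := by
    have h1 : δ ^ 2 ≤ Real.sqrt (c / 4) ^ 2 := by
      gcongr
      exact min_le_right _ _
    rw [Real.sq_sqrt (by positivity)] at h1
    linarith
  intro μ _ K hμ _ hK hBK hAR hβ
  have hdiam := one_le_diam_of_ball_subset (by omega) hK hBK
  have hSc : IsClosed μ.support := Measure.isClosed_support
  obtain ⟨R, hR, hRdens⟩ := hμ.exists_almost_constant_density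
    (F := μ.support ∩ closedBall 0 2) ((isCompact_closedBall 0 2).inter_left hSc)
    inter_subset_left hα hα' N
  have key : ∀ x ∈ μ.support ∩ ball 0 1, ∀ r : ℝ, 0 < r → r < min R (1 / 16) →
      theta n μ.support x r < ε := by
    intro x hx r hr hrR
    have hrR1 : r < R := hrR.trans_le (min_le_left _ _)
    have hr16 : r < 1 / 16 := hrR.trans_le (min_le_right _ _)
    have hx1 := mem_ball.1 hx.2
    have hball : ball x (8 * r) ⊆ ball 0 2 := ball_subset_ball' (by linarith)
    obtain ⟨L, hL, hflat⟩ := exists_plane_infDist_le (μ := μ) hnm.le hφ (C₀ := C₀) (x := x)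
      (r := 8 * r) (τ := τ / 8) (by positivity) hδ0 (by positivity) (by linarith) hδc
      (hβ x ⟨hBK (ball_subset_ball (by norm_num) hx.2), hx.1⟩ _ (by positivity) hball)
      (fun w hw => (hAR w ⟨hBK (hball hw.2), hw.1⟩ _ (by positivity) (by nlinarith)).1)
    refine (theta_lt_of_infDist_le_of_no_hole (ε := ε') (τ := τ) hSc hx.1 hr hε'0 hε'1 hτ0 hτε
      hL (fun w hw => (hflat w hw).trans_eq (by ring)) ?_).trans_le (min_le_left _ _)
    intro W hW p hp hpflat y hy hge hlt hmin
    rw [mem_ball] at hp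
    set ρ := dist p y with hρ
    have hρ0 : 0 < ρ := lt_of_lt_of_le (by positivity) hge
    -- Here `dist y x < 2 * r` and `ρ < r`, which is why flatness was taken on the larger ball.
    have hsub : ball y (4 * ρ) ⊆ ball x (8 * r) := by
      refine ball_subset_ball' ?_
      have := dist_triangle_left y x p
      linarith
    have hyx : y ∈ ball x (8 * r) := hsub (mem_ball_self (by positivity))
    obtain ⟨D, hD, h1, h2, h3⟩ := hRdens y ⟨hy, ball_subset_closedBall (hball hyx)⟩ ρ hρ0
      (hlt.trans hrR1)
      (fun w hw => ⟨hw.1, ball_subset_closedBall (hball (hsub hw.2))⟩)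
    refine absurd hαlt (not_lt.2 (density_deficit_of_hole hW hα hα' hNα hρ0 hD rfl hy hmin ?_
      h1 h2 h3))
    intro w hw
    obtain ⟨v, hv⟩ := hpflat w ⟨hw.1, hsub hw.2⟩
    refine ⟨v, hv.trans ?_⟩
    have h4 : α ^ (N + 1) * (ε' * r / 8) ≤ α ^ (N + 1) * ρ := by gcongr
    have h5 : 2 * τ * r = α ^ (N + 1) * (ε' * r / 8) := by rw [hτ]; ring
    linarith
  have hRmin : 0 < min R (1 / 16 : ℝ) := lt_min hR (by norm_num)
  exact ⟨⟨_, hRmin, key⟩, isReifenbergFlat_inter_of_isOpen isOpen_ball hRmin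
    fun x hx r hr hrR => (key x hx r hr hrR).le⟩
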